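/- Let $\sigma_X>0$. There is a constant $c_*>0$ depending only on $\sigma_X$ such that the following holds for all integers $n\ge 1$, $1\le s\le p$ and all $\sigma>0$. Let $X$ be a random $n\times p$ real matrix whose distribution is isotropic, i.e. $\mathbf E(X^\top X/n)=I_p$, and whose rows $\mathbf x_1,\dots,\mathbf x_n$ are independent and $\sigma_X$-subgaussian, i.e. $\mathbf E\exp(t\langle \mathbf x_i,v\rangle)\le \exp(\sigma_X^2t^2/2)$ for all $i$, all $t\in\mathbb R$ and all $v\in\mathbb R^p$ with $\|v\|_2=1$. For $\theta\in\mathbb R^p$ let $\mathbf E_\theta$ be the expectation with respect to the joint distribution of $(X,Y)$, where $Y=X\theta+\sigma\xi$ and $\xi\sim\mathcal N(0,I_n)$ is independent of $X$. Let $B_0(s)$ be the set of vectors in $\mathbb R^p$ with at most $s$ nonzero coordinates, and let $$\lambda=\sigma\min\left(\sqrt{\frac{s\log(2+p/s^2)}{n}},\ n^{-1/4},\ \frac{p^{1/4}}{\sqrt n}\right).$$ Then $$\inf_{\hat T}\ \sup_{\theta\in B_0(s)}\mathbf E_\theta\big[(\hat T-\|\theta\|_2)^2\big]\ \ge\ c_*\lambda^2,$$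 where $\inf_{\hat T}$ is the infimum over all estimators, i.e. all real-valued measurable functions $\hat T=\hat T(X,Y)$. -/

import Mathlib

open MeasureTheory ProbabilityTheory
open scoped ENNReal NNReal

namespace SparseRegression

/-- The product (that is, Borel) sigma-algebra on real `n × p` matrices. -/
instance matrixMeasurableSpace (n p : ℕ) : MeasurableSpace (Matrix (Fin n) (Fin p) ℝ) :=
  inferInstanceAs (MeasurableSpace (Fin n → Fin p → ℝ))

/-- A real random variable `ζ` is `b`-subgaussian: `E exp (t ζ) ≤ exp (b ^ 2 t ^ 2 / 2)` for all
real `t` (the expectation being finite). -/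
def IsSubgaussian {Ω : Type*} [MeasurableSpace Ω] (b : ℝ≥0) (ζ : Ω → ℝ) (P : Measure Ω) : Prop :=
  HasSubgaussianMGF ζ (b ^ 2) P

/-- A random vector `η` is `b`-subgaussian: `⟨η, v⟩` is `b`-subgaussian for all unit `v`. -/
def IsSubgaussianVector {Ω : Type*} [MeasurableSpace Ω] {d : ℕ} (b : ℝ≥0)
    (η : Ω → EuclideanSpace ℝ (Fin d)) (P : Measure Ω) : Prop :=
  ∀ v : EuclideanSpace ℝ (Fin d), ‖v‖ = 1 → IsSubgaussian b (fun ω => inner ℝ (η ω) v) P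

/-- The `i`-th row of a matrix, as a vector of the Euclidean space. -/
noncomputable def row {n p : ℕ} (i : Fin n) (X : Matrix (Fin n) (Fin p) ℝ) :
    EuclideanSpace ℝ (Fin p) :=
  WithLp.toLp 2 (X i)

/-- The law `PX` of the random matrix `X` is isotropic: `E (Xᵀ X / n) = I_p`, entry by entry. -/
def IsIsotropic {n p : ℕ} (PX : Measure (Matrix (Fin n) (Fin p) ℝ)) : Prop :=
  ∀ j k : Fin p,
    Integrable (fun X => ((1 / (n : ℝ)) • (X.transpose * X)) j k) PX ∧
    ∫ X, ((1 / (n : ℝ)) • (X.transpose * X)) j k ∂PX = (1 : Matrix (Fin p) (Fin p) ℝ) j k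

/-- Under the law `PX` of `X`, the rows are independent and each of them is `b`-subgaussian. -/
def HasIndepSubgaussianRows {n p : ℕ} (b : ℝ≥0)
    (PX : Measure (Matrix (Fin n) (Fin p) ℝ)) : Prop :=
  iIndepFun (fun i : Fin n => row (p := p) i) PX ∧
    ∀ i : Fin n, IsSubgaussianVector b (row (p := p) i) PX

/-- The space of the observations `(X, Y)`. -/
abbrev Obs (n p : ℕ) : Type := Matrix (Fin n) (Fin p) ℝ × EuclideanSpace ℝ (Fin n)

/-- The map `(X, ξ) ↦ (X, X θ + σ ξ)`. -/
noncomputable def observe {n p : ℕ} (σ : ℝ) (θ : EuclideanSpace ℝ (Fin p)) (w : Obs n p) :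
    Obs n p :=
  (w.1, WithLp.toLp 2 (w.1.mulVec θ.ofLp) + σ • w.2)

/-- The joint law `P_θ` of `(X, Y)` in the model `Y = X θ + σ ξ`, where `X` has law `PX`,
`ξ` is standard Gaussian in `ℝ^n`, and `X`, `ξ` are independent. -/
noncomputable def jointLaw {n p : ℕ} (PX : Measure (Matrix (Fin n) (Fin p) ℝ)) (σ : ℝ)
    (θ : EuclideanSpace ℝ (Fin p)) : Measure (Obs n p) :=
  (PX.prod (stdGaussian (EuclideanSpace ℝ (Fin n)))).map (observe σ θ)

theorem measurable_entry {n p : ℕ} (i : Fin n) (j : Fin p) :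
    Measurable (fun X : Matrix (Fin n) (Fin p) ℝ => X i j) :=
  (measurable_pi_apply j).comp
    (measurable_pi_apply (X := fun _ : Fin n => Fin p → ℝ) i)

theorem measurable_observe {n p : ℕ} (σ : ℝ) (θ : EuclideanSpace ℝ (Fin p)) :
    Measurable (observe (n := n) σ θ) := by
  refine measurable_fst.prodMk (Measurable.add ?_ (measurable_snd.const_smul σ))
  refine (WithLp.measurable_toLp 2 (Fin n → ℝ)).comp (measurable_pi_lambda _ fun i => ?_)
  simp only [Matrix.mulVec, dotProduct]
  exact Finset.measurable_sum _ fun j _ =>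
    ((measurable_entry i j).comp measurable_fst).mul_const _

instance isProbabilityMeasure_jointLaw {n p : ℕ} (PX : Measure (Matrix (Fin n) (Fin p) ℝ))
    [IsProbabilityMeasure PX] (σ : ℝ) (θ : EuclideanSpace ℝ (Fin p)) :
    IsProbabilityMeasure (jointLaw PX σ θ) :=
  Measure.isProbabilityMeasure_map (measurable_observe σ θ).aemeasurable

/-- The `s`-sparse vectors `B₀(s)` of `ℝ^p`: at most `s` nonzero coordinates. -/
def sparseBall (p s : ℕ) : Set (EuclideanSpace ℝ (Fin p)) :=
  {u | hammingNorm u.ofLp ≤ s}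

/-- The quantity
`σ min (√(s log (2 + p / s ^ 2) / n), n ^ (-1/4), p ^ (1/4) / √n)`. -/
noncomputable def rate (n p s : ℕ) (σ : ℝ) : ℝ :=
  σ * min (Real.sqrt ((s : ℝ) * Real.log (2 + (p : ℝ) / (s : ℝ) ^ 2) / (n : ℝ)))
    (min ((n : ℝ) ^ (-(1 / 4) : ℝ)) ((p : ℝ) ^ (1 / 4 : ℝ) / Real.sqrt (n : ℝ)))

/-- The worst-case squared risk `sup_{θ ∈ B₀(s)} E_θ (T - ‖θ‖₂)²` (possibly infinite) of an
estimator `T = T(X, Y)` of the norm. -/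
noncomputable def worstRisk {n p : ℕ} (PX : Measure (Matrix (Fin n) (Fin p) ℝ)) (σ : ℝ) (s : ℕ)
    (T : Obs n p → ℝ) : ℝ≥0∞ :=
  ⨆ θ ∈ sparseBall p s, ∫⁻ ω, ENNReal.ofReal ((T ω - ‖θ‖) ^ 2) ∂(jointLaw PX σ θ)

/-- The minimax squared risk: the infimum of the worst-case risk over all estimators, that is,
over all measurable functions of `(X, Y)`. -/
noncomputable def minimaxRisk {n p : ℕ} (PX : Measure (Matrix (Fin n) (Fin p) ℝ)) (σ : ℝ)
    (s : ℕ) : ℝ≥0∞ :=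
  ⨅ (T : Obs n p → ℝ) (_ : Measurable T), worstRisk PX σ s T

end SparseRegression

namespace SparseRegression

/-! Le Cam's method: compare `θ = 0` with a uniform mixture of sparse vectors, all of norm `ρ`
proportional to `λ`. Either `T` is below `ρ / 2` with probability over one half at some alternative,
or `T ≥ ρ / 2` with probability at least one half at all of them. In the second case Cauchy–Schwarz
against the mixture likelihood gives this event null probability at least `1 / (4K)`, where `K`
bounds the second moment of that likelihood. So a bounded `K` suffices
(`le_minimaxRisk_of_chiSquare_le`).

Given `X`, two likelihoods with `θ = ρ u` and `θ' = ρ v` have correlation `exp (w ⟪X u, X v⟫)`, `w =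
ρ² / σ²`. The exponent is a sum over independent rows of products of subgaussian variables, with
total mean `n w ⟪u, v⟫` by isotropy. Its exponential moment is therefore at most `exp (n w ⟪u, v⟫ +
O(n w²))` (`lintegral_exp_inner_mulVec_le`). The `n ^ (-1/4)` term of the rate bounds `n w²`.

For block vectors, `⟪u, v⟫` is the fraction of the `k` blocks where two positions agree. Under
uniform choice the number of agreements is binomial `(k, 1/m)`, so the remaining average is at most
`exp (k (exp (n w / k) - 1) / m)` (`sum_exp_card_agree_le`). The other two terms of the rate bound
this, with `k` the smaller of `s` and `⌊√p⌋` (`exists_block_parameters`). -/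

/-! ### Shifts of the standard Gaussian measure. -/

theorem lintegral_pi_prod {ι : Type*} [Fintype ι] {α : ι → Type*} [∀ i, MeasurableSpace (α i)]
    (μ : ∀ i, Measure (α i)) [∀ i, IsProbabilityMeasure (μ i)] {g : ∀ i, α i → ℝ≥0∞}
    (hg : ∀ i, Measurable (g i)) :
    ∫⁻ x, ∏ i, g i (x i) ∂(Measure.pi μ) = ∏ i, ∫⁻ x, g i x ∂(μ i) := by
  have h := lintegral_prod_eq_prod_lintegral_of_indepFun Finset.univ
    (fun i (x : ∀ i, α i) => g i (x i))
    (iIndepFun_pi (μ := μ) (X := g) fun i => (hg i).aemeasurable)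
    (fun i => (hg i).comp (measurable_pi_apply i))
  rw [h]
  refine Finset.prod_congr rfl fun i _ => ?_
  exact (measurePreserving_eval μ i).lintegral_comp (hg i)

theorem pi_withDensity {ι : Type*} [Fintype ι] {α : ι → Type*} [∀ i, MeasurableSpace (α i)]
    (μ : ∀ i, Measure (α i)) [∀ i, IsProbabilityMeasure (μ i)] {g : ∀ i, α i → ℝ≥0∞}
    (hg : ∀ i, Measurable (g i)) [∀ i, SigmaFinite ((μ i).withDensity (g i))] :
    Measure.pi (fun i => (μ i).withDensity (g i)) =
      (Measure.pi μ).withDensity (fun x => ∏ i, g i (x i)) := by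
  refine Measure.pi_eq fun s hs => ?_
  rw [withDensity_apply _ (MeasurableSet.univ_pi hs), ← lintegral_indicator
    (MeasurableSet.univ_pi hs)]
  have h : ∀ x : ∀ i, α i, (Set.univ.pi s).indicator (fun x => ∏ i, g i (x i)) x =
      ∏ i, (s i).indicator (g i) (x i) := by
    intro x
    by_cases hx : x ∈ Set.univ.pi s
    · rw [Set.indicator_of_mem hx]
      exact Finset.prod_congr rfl fun i _ => (Set.indicator_of_mem (hx i trivial) _).symm
    · rw [Set.indicator_of_notMem hx]
      simp only [Set.mem_pi, Set.mem_univ, true_implies, not_forall] at hx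
      obtain ⟨i, hi⟩ := hx
      exact (Finset.prod_eq_zero (Finset.mem_univ i) (Set.indicator_of_notMem hi _)).symm
  simp_rw [h]
  rw [lintegral_pi_prod μ fun i => (hg i).indicator (hs i)]
  refine Finset.prod_congr rfl fun i _ => ?_
  rw [lintegral_indicator (hs i), withDensity_apply _ (hs i)]

theorem gaussianReal_map_add_eq_withDensity (h : ℝ) :
    (gaussianReal 0 1).map (· + h) =
      (gaussianReal 0 1).withDensity (fun x => ENNReal.ofReal (Real.exp (h * x - h ^ 2 / 2))) := by
  rw [gaussianReal_map_add_const, gaussianReal_of_var_ne_zero _ one_ne_zero,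
    gaussianReal_of_var_ne_zero _ one_ne_zero,
    ← withDensity_mul _ (measurable_gaussianPDF _ _) (by fun_prop)]
  congr 1
  ext x
  simp only [Pi.mul_apply, gaussianPDF, gaussianPDFReal]
  rw [← ENNReal.ofReal_mul (by positivity), mul_assoc (√_)⁻¹ (Real.exp _), ← Real.exp_add]
  congr 3
  simp only [NNReal.coe_one]
  ring

/-- The **Cameron–Martin formula** for the standard Gaussian measure. -/
theorem lintegral_stdGaussian_add {n : ℕ} (h : EuclideanSpace ℝ (Fin n))
    {f : EuclideanSpace ℝ (Fin n) → ℝ≥0∞} (hf : Measurable f) :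
    ∫⁻ x, f (x + h) ∂(stdGaussian (EuclideanSpace ℝ (Fin n))) =
      ∫⁻ x, ENNReal.ofReal (Real.exp (inner ℝ h x - ‖h‖ ^ 2 / 2)) * f x
        ∂(stdGaussian (EuclideanSpace ℝ (Fin n))) := by
  have hL : Measurable (WithLp.toLp 2 : (Fin n → ℝ) → EuclideanSpace ℝ (Fin n)) :=
    WithLp.measurable_toLp 2 _
  rw [← map_pi_eq_stdGaussian, lintegral_map (by fun_prop) hL, lintegral_map (by fun_prop) hL]
  have hshift : (Measure.pi fun _ : Fin n => gaussianReal 0 1).map (fun x i => x i + h i) =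
      (Measure.pi fun _ : Fin n => gaussianReal 0 1).withDensity
        (fun x => ∏ i, ENNReal.ofReal (Real.exp (h i * x i - h i ^ 2 / 2))) := by
    have hs : ∀ i : Fin n, SigmaFinite ((gaussianReal 0 1).withDensity
        (fun x => ENNReal.ofReal (Real.exp (h i * x - h i ^ 2 / 2)))) := fun i => by
      rw [← gaussianReal_map_add_eq_withDensity, gaussianReal_map_add_const]; infer_instance
    rw [← pi_withDensity (fun _ : Fin n => gaussianReal 0 1)
      (g := fun i x => ENNReal.ofReal (Real.exp (h i * x - h i ^ 2 / 2)))
      (fun i => by fun_prop)]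
    simp_rw [← gaussianReal_map_add_eq_withDensity]
    have hs' : ∀ i : Fin n, SigmaFinite ((gaussianReal 0 1).map (· + h i)) := fun i => by
      rw [gaussianReal_map_add_const]; infer_instance
    exact Measure.pi_map_pi (μ := fun _ : Fin n => gaussianReal 0 1)
      (f := fun i x => x + h i) (fun i => by fun_prop)
  have h1 : ∫⁻ x, f (WithLp.toLp 2 x + h) ∂(Measure.pi fun _ : Fin n => gaussianReal 0 1) =
      ∫⁻ x, f (WithLp.toLp 2 x) ∂((Measure.pi fun _ : Fin n => gaussianReal 0 1).map
        (fun x i => x i + h i)) := by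
    rw [lintegral_map (by fun_prop) (by fun_prop)]
    rfl
  rw [h1, hshift, lintegral_withDensity_eq_lintegral_mul _ (by fun_prop) (by fun_prop)]
  refine lintegral_congr fun x => ?_
  simp only [Pi.mul_apply]
  rw [← ENNReal.ofReal_prod_of_nonneg fun i _ => (Real.exp_pos _).le, ← Real.exp_sum]
  congr 3
  rw [Finset.sum_sub_distrib, ← Finset.sum_div, EuclideanSpace.real_norm_sq_eq]
  simp [PiLp.inner_apply, mul_comm]

theorem lintegral_exp_inner_stdGaussian {n : ℕ} (h : EuclideanSpace ℝ (Fin n)) :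
    ∫⁻ x, ENNReal.ofReal (Real.exp (inner ℝ h x)) ∂(stdGaussian (EuclideanSpace ℝ (Fin n))) =
      ENNReal.ofReal (Real.exp (‖h‖ ^ 2 / 2)) := by
  have h1 := lintegral_stdGaussian_add h (f := fun _ => ENNReal.ofReal (Real.exp (‖h‖ ^ 2 / 2)))
    measurable_const
  rw [lintegral_const, measure_univ, mul_one] at h1
  rw [h1]
  refine lintegral_congr fun x => ?_
  rw [← ENNReal.ofReal_mul (Real.exp_pos _).le, ← Real.exp_add]
  congr 2
  ring

/-- The Gaussian likelihood ratios `exp (⟪h, ·⟫ - ‖h‖² / 2)` have correlations `exp ⟪h, h'⟫`. -/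
theorem lintegral_likelihood_mul {n : ℕ} (h h' : EuclideanSpace ℝ (Fin n)) :
    ∫⁻ x, ENNReal.ofReal (Real.exp (inner ℝ h x - ‖h‖ ^ 2 / 2)) *
        ENNReal.ofReal (Real.exp (inner ℝ h' x - ‖h'‖ ^ 2 / 2))
          ∂(stdGaussian (EuclideanSpace ℝ (Fin n))) =
      ENNReal.ofReal (Real.exp (inner ℝ h h')) := by
  -- Cameron–Martin read backwards: the first likelihood is absorbed as a shift by `h`.
  rw [← lintegral_stdGaussian_add h (by fun_prop)]
  have : ∀ x : EuclideanSpace ℝ (Fin n),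
      ENNReal.ofReal (Real.exp (inner ℝ h' (x + h) - ‖h'‖ ^ 2 / 2)) =
        ENNReal.ofReal (Real.exp (inner ℝ h h' - ‖h'‖ ^ 2 / 2)) *
          ENNReal.ofReal (Real.exp (inner ℝ h' x)) := fun x => by
    rw [← ENNReal.ofReal_mul (Real.exp_pos _).le, ← Real.exp_add, inner_add_right,
      real_inner_comm h h']
    congr 2
    ring
  simp_rw [this]
  rw [lintegral_const_mul _ (by fun_prop), lintegral_exp_inner_stdGaussian,
    ← ENNReal.ofReal_mul (Real.exp_pos _).le, ← Real.exp_add]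
  congr 2
  ring

/-! ### Exponential moments of products of subgaussian variables. -/

/-- The square of a subgaussian variable has an exponential moment. -/
theorem lintegral_exp_sq_le_of_hasSubgaussianMGF {Ω : Type*} [MeasurableSpace Ω] {P : Measure Ω}
    [IsProbabilityMeasure P] {U : Ω → ℝ} {c : ℝ≥0} (hc : 0 < c) (hU : Measurable U)
    (h : HasSubgaussianMGF U c P) :
    ∫⁻ ω, ENNReal.ofReal (Real.exp (U ω ^ 2 / (4 * c))) ∂P ≤ 2 := by
  have hc' : (0 : ℝ) < c := hc
  -- For `g ∼ N(0, v)`, `E exp (U g) = exp (U² / (4c))`. After exchanging the integrals, `E exp (c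
  -- g² / 2)` is finite because `c v = 1/2 < 1`; it equals `√2`.
  set v : ℝ≥0 := 1 / (2 * c) with hv
  have hv0 : v ≠ 0 := by positivity
  have hgauss : ∀ ω, ENNReal.ofReal (Real.exp (U ω ^ 2 / (4 * c))) =
      ∫⁻ g, ENNReal.ofReal (Real.exp (U ω * g)) ∂(gaussianReal 0 v) := fun ω => by
    rw [← ofReal_integral_eq_lintegral_ofReal (integrable_exp_mul_gaussianReal _)
      (Filter.Eventually.of_forall fun _ => (Real.exp_pos _).le)]
    have := congrFun (mgf_fun_id_gaussianReal (μ := 0) (v := v)) (U ω)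
    rw [mgf] at this
    rw [this]
    congr 2
    rw [hv]; push_cast; field_simp; ring
  simp_rw [hgauss]
  rw [lintegral_lintegral_swap (by fun_prop)]
  have hmgf : ∀ g : ℝ, ∫⁻ ω, ENNReal.ofReal (Real.exp (U ω * g)) ∂P ≤
      ENNReal.ofReal (Real.exp (c * g ^ 2 / 2)) := fun g => by
    simp_rw [mul_comm (U _) g]
    rw [← ofReal_integral_eq_lintegral_ofReal (h.integrable_exp_mul g)
      (Filter.Eventually.of_forall fun _ => (Real.exp_pos _).le)]
    exact ENNReal.ofReal_le_ofReal (h.mgf_le g)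
  refine (lintegral_mono hmgf).trans ?_
  rw [gaussianReal_of_var_ne_zero _ hv0,
    lintegral_withDensity_eq_lintegral_mul _ (measurable_gaussianPDF _ _) (by fun_prop)]
  have hprod : ∀ g : ℝ, (gaussianPDF 0 v * fun g : ℝ => ENNReal.ofReal (Real.exp (c * g ^ 2 / 2))) g
      = ENNReal.ofReal (√(c / Real.pi) * Real.exp (-(c / 2 : ℝ) * g ^ 2)) := fun g => by
    simp only [Pi.mul_apply, gaussianPDF, gaussianPDFReal]
    rw [← ENNReal.ofReal_mul (by positivity), mul_assoc, ← Real.exp_add, ← Real.sqrt_inv]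
    congr 3
    · rw [hv]; push_cast; field_simp
    · rw [hv]; push_cast; field_simp; ring
  simp_rw [hprod]
  rw [← ofReal_integral_eq_lintegral_ofReal
    ((integrable_exp_neg_mul_sq (by positivity)).const_mul _)
    (Filter.Eventually.of_forall fun _ => by positivity), integral_const_mul, integral_gaussian,
    ← Real.sqrt_mul (by positivity)]
  have : (c / Real.pi * (Real.pi / (c / 2)) : ℝ) = 2 := by
    have := Real.pi_pos
    field_simp
  rw [this, ENNReal.ofReal_le_iff_le_toReal (by simp)]
  simp only [ENNReal.toReal_ofNat]
  exact Real.sqrt_le_iff.2 ⟨by norm_num, by norm_num⟩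

/-- Taylor's remainder is at most `(r t)² exp (|t| / 2)`, and `t² ≤ 8 exp (|t| / 2)`. The linear
term is kept exact so that integration produces the mean, with an error quadratic in `r`. -/
theorem exp_mul_le_one_add_add_sq_mul_exp {r t : ℝ} (hr : 0 ≤ r) (hr' : r ≤ 1 / 2) :
    Real.exp (r * t) ≤ 1 + r * t + 8 * r ^ 2 * Real.exp |t| := by
  have h1 : |Real.exp (r * t) - (1 + r * t)| ≤ (|r| * |t|) ^ 2 * Real.exp (|r| * |t|) := by
    have h := Complex.norm_exp_sub_sum_le_norm_mul_exp ((r * t : ℝ) : ℂ) 2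
    simp only [Finset.sum_range_succ, Finset.sum_range_zero, Complex.norm_real, Real.norm_eq_abs,
      abs_mul] at h
    rw [← Real.norm_eq_abs, ← Complex.norm_real]
    simpa using h
  have h2 := (abs_le.1 h1).2
  have h3 : Real.exp (|r| * |t|) ≤ Real.exp (|t| / 2) := by
    rw [abs_of_nonneg hr]
    exact Real.exp_le_exp.2 (by nlinarith [abs_nonneg t])
  have h4 := Real.quadratic_le_exp_of_nonneg (x := |t| / 2) (by positivity)
  have h5 : t ^ 2 ≤ 8 * Real.exp (|t| / 2) := by
    rw [← sq_abs t]; nlinarith [abs_nonneg t]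
  have h6 : Real.exp |t| = Real.exp (|t| / 2) * Real.exp (|t| / 2) := by
    rw [← Real.exp_add]; congr 1; ring
  have h7 : (r * t) ^ 2 * Real.exp (|r| * |t|) ≤ 8 * r ^ 2 * Real.exp |t| := by
    rw [h6]
    calc (r * t) ^ 2 * Real.exp (|r| * |t|) = r ^ 2 * (t ^ 2 * Real.exp (|r| * |t|)) := by ring
      _ ≤ r ^ 2 * (8 * Real.exp (|t| / 2) * Real.exp (|t| / 2)) := by gcongr
      _ = _ := by ring
  have h8 : (|r| * |t|) ^ 2 = (r * t) ^ 2 := by rw [← abs_mul, sq_abs]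
  rw [h8] at h2
  linarith

/-- The product of two subgaussian variables is subexponential. -/
theorem lintegral_exp_mul_mul_le_of_hasSubgaussianMGF {Ω : Type*} [MeasurableSpace Ω]
    {P : Measure Ω} [IsProbabilityMeasure P] {U V : Ω → ℝ} {c : ℝ≥0} (hc : 0 < c)
    (hU : Measurable U) (hV : Measurable V) (h : HasSubgaussianMGF U c P)
    (h' : HasSubgaussianMGF V c P) {w : ℝ} (hw : 0 ≤ w) (hw' : w ≤ 1 / (8 * c)) :
    ∫⁻ ω, ENNReal.ofReal (Real.exp (w * (U ω * V ω))) ∂P ≤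
      ENNReal.ofReal (Real.exp (w * ∫ ω, U ω * V ω ∂P + 256 * (c * w) ^ 2)) := by
  have hc' : (0 : ℝ) < c := hc
  have hint : Integrable (fun ω => U ω * V ω) P :=
    MemLp.integrable_mul (p := 2) (q := 2) (h.memLp 2) (h'.memLp 2)
  have hsq : ∀ {W : Ω → ℝ}, Measurable W → HasSubgaussianMGF W c P →
      Integrable (fun ω => Real.exp (W ω ^ 2 / (4 * c))) P ∧
        ∫ ω, Real.exp (W ω ^ 2 / (4 * c)) ∂P ≤ 2 := by
    intro W hW hsub
    have hle := lintegral_exp_sq_le_of_hasSubgaussianMGF hc hW hsub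
    have hi : Integrable (fun ω => Real.exp (W ω ^ 2 / (4 * c))) P := by
      refine ⟨by fun_prop, ?_⟩
      rw [hasFiniteIntegral_iff_ofReal (Filter.Eventually.of_forall fun _ => (Real.exp_pos _).le)]
      exact hle.trans_lt (by simp)
    refine ⟨hi, ?_⟩
    rw [← ofReal_integral_eq_lintegral_ofReal hi
      (Filter.Eventually.of_forall fun _ => (Real.exp_pos _).le)] at hle
    simpa using (ENNReal.ofReal_le_iff_le_toReal (by simp)).1 hle
  obtain ⟨hiU, hbU⟩ := hsq hU h
  obtain ⟨hiV, hbV⟩ := hsq hV h'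
  set F : Ω → ℝ := fun ω => 1 + w * (U ω * V ω) + 8 * (4 * c * w) ^ 2 *
    ((Real.exp (U ω ^ 2 / (4 * c)) + Real.exp (V ω ^ 2 / (4 * c))) / 2) with hF
  have hpt : ∀ ω, Real.exp (w * (U ω * V ω)) ≤ F ω := by
    intro ω
    -- This scaling bounds `|t|` by the mean of `U² / (4c)` and `V² / (4c)`, whose exponentials have
    -- expectation at most 2. The final constant is `8 · 4² · 2 = 256`.
    have h1 := exp_mul_le_one_add_add_sq_mul_exp (r := 4 * c * w) (t := U ω * V ω / (4 * c))
      (by positivity) (by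
        calc 4 * c * w ≤ 4 * c * (1 / (8 * c)) := by gcongr
          _ = 1 / 2 := by field_simp; norm_num)
    have h2 : 4 * c * w * (U ω * V ω / (4 * c)) = w * (U ω * V ω) := by field_simp
    rw [h2] at h1
    refine h1.trans ?_
    simp only [hF]
    gcongr
    have h3 : |U ω * V ω / (4 * c)| ≤ (U ω ^ 2 / (4 * c)) / 2 + (V ω ^ 2 / (4 * c)) / 2 := by
      rw [abs_div, abs_of_pos (show (0 : ℝ) < 4 * c by positivity), abs_mul]
      have h4 : (U ω ^ 2 / (4 * c)) / 2 + (V ω ^ 2 / (4 * c)) / 2 =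
          ((|U ω| ^ 2 + |V ω| ^ 2) / 2) / (4 * c) := by rw [sq_abs, sq_abs]; ring
      rw [h4]
      gcongr
      nlinarith [sq_nonneg (|U ω| - |V ω|)]
    refine (Real.exp_le_exp.2 h3).trans ?_
    rw [Real.exp_add]
    have hx : ∀ x : ℝ, Real.exp x = Real.exp (x / 2) * Real.exp (x / 2) := fun x => by
      rw [← Real.exp_add]; congr 1; ring
    rw [hx (U ω ^ 2 / (4 * c)), hx (V ω ^ 2 / (4 * c))]
    nlinarith [sq_nonneg (Real.exp (U ω ^ 2 / (4 * c) / 2) - Real.exp (V ω ^ 2 / (4 * c) / 2))]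
  have hi1 : Integrable (fun ω => 1 + w * (U ω * V ω)) P :=
    (integrable_const _).add (hint.const_mul _)
  have hi2 : Integrable (fun ω => 8 * (4 * c * w) ^ 2 *
      ((Real.exp (U ω ^ 2 / (4 * c)) + Real.exp (V ω ^ 2 / (4 * c))) / 2)) P :=
    ((hiU.add hiV).div_const _).const_mul _
  have hFi : Integrable F P := hi1.add hi2
  calc ∫⁻ ω, ENNReal.ofReal (Real.exp (w * (U ω * V ω))) ∂P
      ≤ ∫⁻ ω, ENNReal.ofReal (F ω) ∂P :=
        lintegral_mono fun ω => ENNReal.ofReal_le_ofReal (hpt ω)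
    _ = ENNReal.ofReal (∫ ω, F ω ∂P) :=
        (ofReal_integral_eq_lintegral_ofReal hFi
          (Filter.Eventually.of_forall fun ω => (Real.exp_pos _).le.trans (hpt ω))).symm
    _ ≤ _ := by
        refine ENNReal.ofReal_le_ofReal ?_
        have : ∫ ω, F ω ∂P = 1 + w * ∫ ω, U ω * V ω ∂P + 8 * (4 * c * w) ^ 2 *
            ((∫ ω, Real.exp (U ω ^ 2 / (4 * c)) ∂P + ∫ ω, Real.exp (V ω ^ 2 / (4 * c)) ∂P) / 2) := by
          simp only [hF]
          rw [integral_add hi1 hi2, integral_add (integrable_const _)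
            (hint.const_mul _), integral_const_mul, integral_const_mul, integral_div,
            integral_add hiU hiV]
          simp
        rw [this]
        refine le_trans ?_ (Real.add_one_le_exp _)
        have h9 : 8 * (4 * c * w) ^ 2 * ((∫ ω, Real.exp (U ω ^ 2 / (4 * c)) ∂P +
            ∫ ω, Real.exp (V ω ^ 2 / (4 * c)) ∂P) / 2) ≤ 8 * (4 * c * w) ^ 2 * 2 := by
          gcongr; linarith
        nlinarith

/-! ### The random design. -/

theorem measurable_row {n p : ℕ} (i : Fin n) : Measurable (row (p := p) i) :=
  (WithLp.measurable_toLp 2 (Fin p → ℝ)).comp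
    (measurable_pi_apply (X := fun _ : Fin n => Fin p → ℝ) i)

theorem toLp_mulVec_apply {n p : ℕ} (X : Matrix (Fin n) (Fin p) ℝ) (u : EuclideanSpace ℝ (Fin p))
    (i : Fin n) : WithLp.toLp 2 (X.mulVec u.ofLp) i = inner ℝ (row i X) u := by
  simp [row, Matrix.mulVec, dotProduct, PiLp.inner_apply, mul_comm]

theorem inner_mulVec {n p : ℕ} (X : Matrix (Fin n) (Fin p) ℝ) (u v : EuclideanSpace ℝ (Fin p)) :
    inner ℝ (WithLp.toLp 2 (X.mulVec u.ofLp)) (WithLp.toLp 2 (X.mulVec v.ofLp)) =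
      ∑ i, inner ℝ (row i X) u * inner ℝ (row i X) v := by
  simp_rw [← toLp_mulVec_apply]
  simp [PiLp.inner_apply, mul_comm]

theorem measurable_toLp_mulVec {n p : ℕ} (u : EuclideanSpace ℝ (Fin p)) :
    Measurable fun X : Matrix (Fin n) (Fin p) ℝ => WithLp.toLp 2 (X.mulVec u.ofLp) := by
  refine (WithLp.measurable_toLp 2 (Fin n → ℝ)).comp (measurable_pi_lambda _ fun i => ?_)
  simp only [Matrix.mulVec, dotProduct]
  exact Finset.measurable_sum _ fun j _ => (measurable_entry i j).mul_const _

theorem inner_mulVec_eq_sum_gram {n p : ℕ} (hn : 1 ≤ n) (X : Matrix (Fin n) (Fin p) ℝ)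
    (u v : EuclideanSpace ℝ (Fin p)) :
    ∑ i, inner ℝ (row i X) u * inner ℝ (row i X) v =
      n * ∑ j, ∑ k, u j * v k * ((1 / (n : ℝ)) • (X.transpose * X)) j k := by
  have hn' : (n : ℝ) ≠ 0 := by positivity
  simp_rw [Finset.mul_sum, Matrix.smul_apply, Matrix.mul_apply, Matrix.transpose_apply,
    smul_eq_mul, Finset.mul_sum]
  have h : ∀ i, inner ℝ (row i X) u * inner ℝ (row i X) v =
      ∑ j, ∑ k, u j * v k * (X i j * X i k) := fun i => by
    simp only [row, PiLp.inner_apply, Finset.sum_mul_sum]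
    refine Finset.sum_congr rfl fun j _ => Finset.sum_congr rfl fun k _ => ?_
    simp only [RCLike.inner_apply, conj_trivial]
    ring
  simp_rw [h]
  rw [Finset.sum_comm]
  refine Finset.sum_congr rfl fun j _ => ?_
  rw [Finset.sum_comm]
  refine Finset.sum_congr rfl fun k _ => Finset.sum_congr rfl fun i _ => ?_
  field_simp

theorem IsIsotropic.integral_inner_mulVec {n p : ℕ} (hn : 1 ≤ n)
    {PX : Measure (Matrix (Fin n) (Fin p) ℝ)} (h : IsIsotropic PX)
    (u v : EuclideanSpace ℝ (Fin p)) :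
    ∫ X, ∑ i, inner ℝ (row i X) u * inner ℝ (row i X) v ∂PX = n * inner ℝ u v := by
  simp_rw [inner_mulVec_eq_sum_gram hn]
  rw [integral_const_mul, integral_finsetSum _ fun j _ => integrable_finsetSum _ fun k _ =>
    (h j k).1.const_mul _]
  congr 1
  have hj : ∀ j, ∫ X, ∑ k, u j * v k * ((1 / (n : ℝ)) • (X.transpose * X)) j k ∂PX =
      u j * v j := fun j => by
    rw [integral_finsetSum _ fun k _ => (h j k).1.const_mul _]
    simp_rw [integral_const_mul, (h j _).2]
    simp [Matrix.one_apply]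
  simp_rw [hj]
  simp [PiLp.inner_apply, mul_comm]

/-- Independence factors the moment over rows, and each factor is subexponential. Isotropy
determines only the sum of the row means, so the means are added up before it is applied; the rows
need not share a law. -/
theorem lintegral_exp_inner_mulVec_le {n p : ℕ} (hn : 1 ≤ n) {b : ℝ≥0} (hb : 0 < b)
    {PX : Measure (Matrix (Fin n) (Fin p) ℝ)} [IsProbabilityMeasure PX] (hiso : IsIsotropic PX)
    (hrows : HasIndepSubgaussianRows b PX) {u v : EuclideanSpace ℝ (Fin p)} (hu : ‖u‖ = 1)
    (hv : ‖v‖ = 1) {w : ℝ} (hw : 0 ≤ w) (hw' : w ≤ 1 / (8 * b ^ 2)) :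
    ∫⁻ X, ENNReal.ofReal (Real.exp (w * inner ℝ (WithLp.toLp 2 (X.mulVec u.ofLp))
        (WithLp.toLp 2 (X.mulVec v.ofLp)))) ∂PX ≤
      ENNReal.ofReal (Real.exp (n * w * inner ℝ u v + n * (256 * (b ^ 2 * w) ^ 2))) := by
  set Z : Fin n → Matrix (Fin n) (Fin p) ℝ → ℝ :=
    fun i X => inner ℝ (row i X) u * inner ℝ (row i X) v with hZ
  have hmeas : ∀ (i : Fin n) (x : EuclideanSpace ℝ (Fin p)),
      Measurable fun X : Matrix (Fin n) (Fin p) ℝ => (inner ℝ (row i X) x : ℝ) := fun i x =>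
    (measurable_row i).inner_const
  have hint : ∀ i, Integrable (Z i) PX := fun i =>
    MemLp.integrable_mul (p := 2) (q := 2) ((hrows.2 i u hu).memLp 2) ((hrows.2 i v hv).memLp 2)
  have hstep : ∀ i, ∫⁻ X, ENNReal.ofReal (Real.exp (w * Z i X)) ∂PX ≤
      ENNReal.ofReal (Real.exp (w * ∫ X, Z i X ∂PX + 256 * (b ^ 2 * w) ^ 2)) := fun i => by
    have := lintegral_exp_mul_mul_le_of_hasSubgaussianMGF (c := b ^ 2) (by positivity)
      (hmeas i u) (hmeas i v) (hrows.2 i u hu) (hrows.2 i v hv) hw (by simpa using hw')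
    simpa [NNReal.coe_pow] using this
  simp_rw [inner_mulVec, Finset.mul_sum, Real.exp_sum]
  simp_rw [ENNReal.ofReal_prod_of_nonneg fun _ _ => (Real.exp_pos _).le]
  rw [lintegral_prod_eq_prod_lintegral_of_indepFun Finset.univ
    (fun i X => ENNReal.ofReal (Real.exp (w * Z i X)))
    (hrows.1.comp (fun _ x => ENNReal.ofReal (Real.exp (w * (inner ℝ x u * inner ℝ x v))))
      fun i => by fun_prop)
    (fun i => by have := hmeas i u; have := hmeas i v; simp only [hZ]; fun_prop)]
  refine (Finset.prod_le_prod' fun i _ => hstep i).trans ?_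
  rw [← ENNReal.ofReal_prod_of_nonneg fun _ _ => (Real.exp_pos _).le, ← Real.exp_sum,
    Finset.sum_add_distrib, ← Finset.mul_sum, ← integral_finsetSum _ fun i _ => hint i,
    hiso.integral_inner_mulVec hn]
  refine le_of_eq ?_
  congr 2
  simp
  ring

/-! ### The second moment method. -/

theorem sq_setLIntegral_le {Ω : Type*} [MeasurableSpace Ω] (Q : Measure Ω) {L : Ω → ℝ≥0∞}
    (hL : Measurable L) {B : Set Ω} (hB : MeasurableSet B) :
    (∫⁻ ω in B, L ω ∂Q) ^ 2 ≤ Q B * ∫⁻ ω, L ω ^ 2 ∂Q := by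
  have h := ENNReal.lintegral_mul_le_Lp_mul_Lq Q Real.HolderConjugate.two_two
    (f := B.indicator 1) (g := L)
    (measurable_one.indicator hB).aemeasurable hL.aemeasurable
  have h1 : ∫⁻ ω, ((B.indicator 1 : Ω → ℝ≥0∞) * L) ω ∂Q = ∫⁻ ω in B, L ω ∂Q := by
    rw [← lintegral_indicator hB]
    refine lintegral_congr fun ω => ?_
    by_cases hω : ω ∈ B <;> simp [hω]
  have h2 : ∫⁻ ω, (B.indicator 1 ω : ℝ≥0∞) ^ (2 : ℝ) ∂Q = Q B := by
    rw [← lintegral_indicator_one hB]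
    refine lintegral_congr fun ω => ?_
    by_cases hω : ω ∈ B <;> simp [hω]
  rw [h1, h2] at h
  calc (∫⁻ ω in B, L ω ∂Q) ^ 2
      ≤ (Q B ^ (1 / 2 : ℝ) * (∫⁻ ω, L ω ^ (2 : ℝ) ∂Q) ^ (1 / 2 : ℝ)) ^ 2 := by gcongr
    _ = _ := by
        rw [mul_pow, ← ENNReal.rpow_mul_natCast, ← ENNReal.rpow_mul_natCast]
        norm_num

/-- The likelihood ratio of the regression model with parameter `θ`, given the design, as a
function of the design and of the noise. -/
noncomputable def likelihood {n p : ℕ} (σ : ℝ) (θ : EuclideanSpace ℝ (Fin p)) (w : Obs n p) :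
    ℝ≥0∞ :=
  ENNReal.ofReal (Real.exp (inner ℝ (σ⁻¹ • WithLp.toLp 2 (w.1.mulVec θ.ofLp)) w.2 -
    ‖σ⁻¹ • WithLp.toLp 2 (w.1.mulVec θ.ofLp)‖ ^ 2 / 2))

theorem measurable_likelihood {n p : ℕ} (σ : ℝ) (θ : EuclideanSpace ℝ (Fin p)) :
    Measurable (likelihood (n := n) σ θ) := by
  have h : Measurable fun w : Obs n p => σ⁻¹ • WithLp.toLp 2 (w.1.mulVec θ.ofLp) :=
    Measurable.const_smul (g := fun w : Obs n p => WithLp.toLp 2 (w.1.mulVec θ.ofLp))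
      ((measurable_toLp_mulVec θ).comp measurable_fst) σ⁻¹
  exact ((((h.inner measurable_snd).sub ((h.norm.pow_const 2).div_const 2)).exp).ennreal_ofReal)

/-- For fixed `X`, the signal is a shift of the noise by `σ⁻¹ X θ`, so Cameron–Martin applies. All
parameters are thus compared on one space, through the null observation map. -/
theorem jointLaw_apply {n p : ℕ} (PX : Measure (Matrix (Fin n) (Fin p) ℝ))
    [IsProbabilityMeasure PX] {σ : ℝ} (hσ : 0 < σ) (θ : EuclideanSpace ℝ (Fin p))
    {A : Set (Obs n p)} (hA : MeasurableSet A) :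
    jointLaw PX σ θ A = ∫⁻ w in observe σ 0 ⁻¹' A, likelihood σ θ w
      ∂(PX.prod (stdGaussian (EuclideanSpace ℝ (Fin n)))) := by
  have hind : Measurable (A.indicator (1 : Obs n p → ℝ≥0∞)) := measurable_one.indicator hA
  have h0 : Measurable (observe (n := n) (p := p) σ 0) := measurable_observe σ 0
  rw [← lintegral_indicator (h0 hA), jointLaw, Measure.map_apply (measurable_observe σ θ) hA,
    ← lintegral_indicator_one ((measurable_observe σ θ) hA),
    lintegral_prod _ (measurable_one.indicator ((measurable_observe σ θ) hA)).aemeasurable,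
    lintegral_prod _ ((measurable_likelihood σ θ).indicator (h0 hA)).aemeasurable]
  refine lintegral_congr fun X => ?_
  have hobs : ∀ ξ, observe σ θ (X, ξ) =
      observe σ 0 (X, ξ + σ⁻¹ • WithLp.toLp 2 (X.mulVec θ.ofLp)) := fun ξ => by
    simp [observe, smul_smul, hσ.ne', add_comm]
  have h1 := lintegral_stdGaussian_add (σ⁻¹ • WithLp.toLp 2 (X.mulVec θ.ofLp))
    (f := fun ξ => A.indicator 1 (observe σ 0 (X, ξ)))
    (hind.comp (h0.comp measurable_prodMk_left))
  simp_rw [← hobs] at h1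
  refine h1.trans (lintegral_congr fun ξ => ?_)
  by_cases h : observe σ 0 (X, ξ) ∈ A
  · rw [Set.indicator_of_mem h, Set.indicator_of_mem (by exact h)]
    simp [likelihood]
  · rw [Set.indicator_of_notMem h, Set.indicator_of_notMem (by exact h), mul_zero]

theorem lintegral_likelihood_mul_likelihood {n p : ℕ} (PX : Measure (Matrix (Fin n) (Fin p) ℝ))
    [IsProbabilityMeasure PX] (σ : ℝ) (θ θ' : EuclideanSpace ℝ (Fin p)) :
    ∫⁻ w, likelihood σ θ w * likelihood σ θ' w
        ∂(PX.prod (stdGaussian (EuclideanSpace ℝ (Fin n)))) =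
      ∫⁻ X, ENNReal.ofReal (Real.exp (σ⁻¹ ^ 2 * inner ℝ (WithLp.toLp 2 (X.mulVec θ.ofLp))
        (WithLp.toLp 2 (X.mulVec θ'.ofLp)))) ∂PX := by
  have hm : Measurable fun w : Obs n p => likelihood σ θ w * likelihood σ θ' w :=
    (measurable_likelihood σ θ).mul (measurable_likelihood σ θ')
  rw [lintegral_prod _ hm.aemeasurable]
  refine lintegral_congr fun X => ?_
  simp only [likelihood]
  rw [lintegral_likelihood_mul, real_inner_smul_left, real_inner_smul_right]
  congr 2
  ring

theorem le_lintegral_sq_sub {Ω : Type*} [MeasurableSpace Ω] (Q : Measure Ω) {T : Ω → ℝ}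
    {B : Set Ω} (hB : MeasurableSet B) {t δ : ℝ} (hδ : 0 ≤ δ) (h : ∀ ω ∈ B, δ ≤ |T ω - t|) :
    ENNReal.ofReal (δ ^ 2) * Q B ≤ ∫⁻ ω, ENNReal.ofReal ((T ω - t) ^ 2) ∂Q := by
  rw [← setLIntegral_const]
  refine (setLIntegral_mono' hB fun ω hω => ?_).trans (setLIntegral_le_lintegral B _)
  refine ENNReal.ofReal_le_ofReal ?_
  rw [← sq_abs (T ω - t)]
  exact pow_le_pow_left₀ hδ (h ω hω) 2

/-- A minimax lower bound by the chi-square divergence of a mixture over sparse vectors of norm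
`ρ` from the null model. -/
theorem le_minimaxRisk_of_chiSquare_le {n p s : ℕ} (PX : Measure (Matrix (Fin n) (Fin p) ℝ))
    [IsProbabilityMeasure PX] {σ ρ K : ℝ} (hσ : 0 < σ) (hρ : 0 ≤ ρ) (hK : 1 ≤ K)
    {ι : Type*} [Fintype ι] [Nonempty ι] {θ : ι → EuclideanSpace ℝ (Fin p)}
    (hnorm : ∀ f, ‖θ f‖ = ρ) (hsparse : ∀ f, θ f ∈ sparseBall p s)
    (hchi : ∑ f, ∑ g, ∫⁻ X, ENNReal.ofReal (Real.exp (σ⁻¹ ^ 2 *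
      inner ℝ (WithLp.toLp 2 (X.mulVec (θ f).ofLp)) (WithLp.toLp 2 (X.mulVec (θ g).ofLp)))) ∂PX ≤
        (Fintype.card ι : ℝ≥0∞) ^ 2 * ENNReal.ofReal K) :
    ENNReal.ofReal (ρ ^ 2 / (16 * K)) ≤ minimaxRisk PX σ s := by
  have hK0 : 0 < K := by linarith
  refine le_iInf₂ fun T hT => ?_
  set A : Set (Obs n p) := {ω | ρ / 2 ≤ T ω} with hA_def
  have hA : MeasurableSet A := measurableSet_le measurable_const hT
  set Q := PX.prod (stdGaussian (EuclideanSpace ℝ (Fin n))) with hQ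
  by_cases hcase : ∃ f, jointLaw PX σ (θ f) A < 1 / 2
  · obtain ⟨f, hf⟩ := hcase
    have hAc : 1 / 2 ≤ jointLaw PX σ (θ f) Aᶜ := by
      rw [prob_compl_eq_one_sub hA]
      refine ENNReal.le_sub_of_add_le_left (measure_ne_top _ _) ?_
      calc jointLaw PX σ (θ f) A + 1 / 2 ≤ 1 / 2 + 1 / 2 := by gcongr
        _ = 1 := ENNReal.add_halves 1
    refine le_trans ?_ (le_iSup₂ (f := fun (θ : EuclideanSpace ℝ (Fin p)) (_ : θ ∈ sparseBall p s)
      => ∫⁻ ω, ENNReal.ofReal ((T ω - ‖θ‖) ^ 2) ∂(jointLaw PX σ θ)) (θ f) (hsparse f))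
    refine le_trans ?_ (le_lintegral_sq_sub _ hA.compl (δ := ρ / 2) (by positivity) fun ω hω => ?_)
    · calc ENNReal.ofReal (ρ ^ 2 / (16 * K))
          ≤ ENNReal.ofReal ((ρ / 2) ^ 2 * (1 / 2)) := by
            refine ENNReal.ofReal_le_ofReal ?_
            rw [div_le_iff₀ (by positivity)]
            nlinarith [sq_nonneg ρ]
        _ = ENNReal.ofReal ((ρ / 2) ^ 2) * (1 / 2) := by
            rw [ENNReal.ofReal_mul (by positivity)]
            congr 1
            rw [ENNReal.ofReal_div_of_pos (by norm_num)]
            simp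
        _ ≤ _ := by gcongr
    · rw [hnorm f, abs_sub_comm]
      have : T ω < ρ / 2 := not_le.1 hω
      exact le_trans (by linarith) (le_abs_self _)
  · push Not at hcase
    set N : ℝ≥0∞ := (Fintype.card ι : ℝ≥0∞) with hN
    have hN0 : N ≠ 0 := by simp [hN]
    have hNtop : N ≠ ∞ := by simp [hN]
    set L : Obs n p → ℝ≥0∞ := fun w => ∑ f, likelihood σ (θ f) w with hL_def
    have hL : Measurable L := Finset.measurable_sum _ fun f _ => measurable_likelihood σ (θ f)
    set B : Set (Obs n p) := observe σ 0 ⁻¹' A with hB_def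
    have hB : MeasurableSet B := measurable_observe σ 0 hA
    have hlow : N / 2 ≤ ∫⁻ w in B, L w ∂Q := by
      rw [lintegral_finsetSum _ fun f _ => measurable_likelihood σ (θ f)]
      simp only [hB_def, hQ, ← jointLaw_apply PX hσ _ hA]
      calc N / 2 = ∑ _f : ι, (1 / 2 : ℝ≥0∞) := by
            simp [hN, div_eq_mul_inv]
        _ ≤ _ := Finset.sum_le_sum fun f _ => hcase f
    have hup : ∫⁻ w, L w ^ 2 ∂Q ≤ N ^ 2 * ENNReal.ofReal K := by
      refine le_trans (le_of_eq ?_) hchi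
      simp_rw [← lintegral_likelihood_mul_likelihood, ← hQ]
      simp_rw [hL_def, sq, Finset.sum_mul_sum]
      have hm : ∀ f g, Measurable fun w : Obs n p =>
          likelihood σ (θ f) w * likelihood σ (θ g) w := fun f g =>
        (measurable_likelihood σ (θ f)).mul (measurable_likelihood σ (θ g))
      rw [lintegral_finsetSum _ fun f _ => Finset.measurable_sum _ fun g _ => hm f g]
      exact Finset.sum_congr rfl fun f _ => lintegral_finsetSum _ fun g _ => hm f g
    -- Cauchy–Schwarz gives `(N / 2)² ≤ Q B · N² K`, and `N²` cancels.
    have hQB : ENNReal.ofReal (1 / (4 * K)) ≤ Q B := by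
      have h1 : N ^ 2 * (1 / 4) ≤ N ^ 2 * (Q B * ENNReal.ofReal K) := by
        calc N ^ 2 * (1 / 4) = (N / 2) ^ 2 := by
              rw [div_eq_mul_inv N 2, mul_pow, ← ENNReal.inv_pow]; norm_num
          _ ≤ (∫⁻ w in B, L w ∂Q) ^ 2 := by gcongr
          _ ≤ Q B * ∫⁻ w, L w ^ 2 ∂Q := sq_setLIntegral_le Q hL hB
          _ ≤ Q B * (N ^ 2 * ENNReal.ofReal K) := by gcongr
          _ = _ := by ring
      have h2 : (1 / 4 : ℝ≥0∞) ≤ Q B * ENNReal.ofReal K :=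
        (ENNReal.mul_le_mul_iff_right (pow_ne_zero 2 hN0) (ENNReal.pow_ne_top hNtop)).1 h1
      have h3 : ENNReal.ofReal (1 / (4 * K)) = (1 / 4) / ENNReal.ofReal K := by
        rw [← div_div, ENNReal.ofReal_div_of_pos hK0, ENNReal.ofReal_div_of_pos (by norm_num)]
        simp
      rw [h3]
      exact ENNReal.div_le_of_le_mul h2
    refine le_trans ?_ (le_iSup₂ (f := fun (θ : EuclideanSpace ℝ (Fin p)) (_ : θ ∈ sparseBall p s)
      => ∫⁻ ω, ENNReal.ofReal ((T ω - ‖θ‖) ^ 2) ∂(jointLaw PX σ θ)) 0 (by simp [sparseBall]))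
    refine le_trans ?_ (le_lintegral_sq_sub _ hA (δ := ρ / 2) (by positivity) fun ω hω => ?_)
    · rw [jointLaw, Measure.map_apply (measurable_observe σ 0) hA]
      calc ENNReal.ofReal (ρ ^ 2 / (16 * K))
          = ENNReal.ofReal ((ρ / 2) ^ 2) * ENNReal.ofReal (1 / (4 * K)) := by
            rw [← ENNReal.ofReal_mul (by positivity)]
            congr 1
            field_simp
            ring
        _ ≤ _ := by gcongr
    · rw [norm_zero, sub_zero]
      exact le_trans hω (le_abs_self _)

/-! ### The block prior. -/

/-- The unit vector with `k` equal nonzero coordinates, one in each of `k` consecutive blocks of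
length `m`; its position in the block `b` is `f b`. -/
noncomputable def blockVector {p k m : ℕ} (h : k * m ≤ p) (f : Fin k → Fin m) :
    EuclideanSpace ℝ (Fin p) :=
  (√(k : ℝ))⁻¹ • ∑ b, EuclideanSpace.single (Fin.castLE h (finProdFinEquiv (b, f b))) (1 : ℝ)

theorem inner_blockVector {p k m : ℕ} (h : k * m ≤ p) (f g : Fin k → Fin m) :
    inner ℝ (blockVector h f) (blockVector h g) =
      (Finset.univ.filter fun b => f b = g b).card / (k : ℝ) := by
  have hs : ∀ b b', inner ℝ
      (EuclideanSpace.single (Fin.castLE h (finProdFinEquiv (b, f b))) (1 : ℝ))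
      (EuclideanSpace.single (Fin.castLE h (finProdFinEquiv (b', g b'))) (1 : ℝ)) =
        if b = b' then (if f b = g b then (1 : ℝ) else 0) else 0 := fun b b' => by
    rw [EuclideanSpace.inner_single_left, map_one, one_mul, PiLp.single_apply]
    by_cases hb : b = b'
    · subst hb
      simp [Fin.castLE_inj]
    · simp [Fin.castLE_inj, hb]
  rw [blockVector, blockVector, real_inner_smul_left, real_inner_smul_right, sum_inner]
  simp_rw [inner_sum, hs]
  simp only [Finset.sum_ite_eq, Finset.mem_univ, if_true, Finset.sum_boole]
  rw [← mul_assoc, ← mul_inv, Real.mul_self_sqrt (Nat.cast_nonneg k)]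
  ring

theorem norm_blockVector {p k m : ℕ} (hk : 1 ≤ k) (h : k * m ≤ p) (f : Fin k → Fin m) :
    ‖blockVector h f‖ = 1 := by
  have hk' : (k : ℝ) ≠ 0 := by positivity
  have h1 : ‖blockVector h f‖ ^ 2 = 1 := by
    rw [← real_inner_self_eq_norm_sq, inner_blockVector]
    simp [hk']
  exact (pow_eq_one_iff_of_nonneg (norm_nonneg _) two_ne_zero).1 h1

theorem smul_blockVector_mem_sparseBall {p k m s : ℕ} (hks : k ≤ s) (h : k * m ≤ p)
    (f : Fin k → Fin m) (ρ : ℝ) : ρ • blockVector h f ∈ sparseBall p s := by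
  refine le_trans ?_ hks
  have hsub : (Finset.univ.filter fun i => (ρ • blockVector h f) i ≠ 0) ⊆
      Finset.univ.image fun b : Fin k => Fin.castLE h (finProdFinEquiv (b, f b)) := by
    intro i hi
    simp only [Finset.mem_filter, Finset.mem_univ, true_and] at hi
    by_contra hni
    simp only [Finset.mem_image, Finset.mem_univ, true_and, not_exists] at hni
    refine hi ?_
    simp only [blockVector, PiLp.smul_apply, smul_eq_mul]
    rw [WithLp.ofLp_sum, Finset.sum_apply, Finset.sum_eq_zero]
    · simp
    · intro b _
      simp [Ne.symm (hni b)]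
  exact (Finset.card_le_card hsub).trans (Finset.card_image_le.trans (by simp))

/-- The sum factors over blocks; in each, one position of `m` agrees with `f`. This gives `m ^ k (1
+ (exp a - 1) / m) ^ k`, then `1 + x ≤ exp x`. -/
theorem sum_exp_card_agree_le {k m : ℕ} (hm : 1 ≤ m) (a : ℝ) (f : Fin k → Fin m) :
    ∑ g : Fin k → Fin m, Real.exp (a * (Finset.univ.filter fun b => f b = g b).card) ≤
      (m : ℝ) ^ k * Real.exp (k * ((Real.exp a - 1) / m)) := by
  have hm' : (0 : ℝ) < m := by positivity
  have hexp : ∀ g : Fin k → Fin m,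
      Real.exp (a * (Finset.univ.filter fun b => f b = g b).card) =
        ∏ b, if f b = g b then Real.exp a else 1 := fun g => by
    rw [Finset.prod_ite, Finset.prod_const, Finset.prod_const_one, mul_one, ← Real.exp_nat_mul,
      mul_comm]
  have hcoord : ∀ b, ∑ j, (if f b = j then Real.exp a else 1) = m * (1 + (Real.exp a - 1) / m) :=
    fun b => by
    have : ∀ j, (if f b = j then Real.exp a else 1) =
        1 + if f b = j then Real.exp a - 1 else 0 := fun j => by split_ifs <;> ring
    simp_rw [this]
    rw [Finset.sum_add_distrib, Finset.sum_ite_eq]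
    simp
    field_simp
  simp_rw [hexp]
  rw [← Fintype.prod_sum fun b j => if f b = j then Real.exp a else 1]
  simp_rw [hcoord]
  rw [Finset.prod_const, Finset.card_univ, Fintype.card_fin, mul_pow, Real.exp_nat_mul]
  have h0 : 0 ≤ 1 + (Real.exp a - 1) / m := by
    have h1 : (1 : ℝ) ≤ m := by exact_mod_cast hm
    have : 1 + (Real.exp a - 1) / m = (m - 1 + Real.exp a) / m := by field_simp; ring
    rw [this]
    have := Real.exp_pos a
    exact div_nonneg (by linarith) hm'.le
  gcongr
  rw [add_comm]
  exact Real.add_one_le_exp _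

/-- The choice of the number `k` of blocks: the smaller of `s` and `√p`. -/
theorem exists_block_parameters {n p s : ℕ} (hn : 1 ≤ n) (hs : 1 ≤ s) (hsp : s ≤ p) {w r : ℝ}
    (hr : r = min (√((s : ℝ) * Real.log (2 + (p : ℝ) / (s : ℝ) ^ 2) / (n : ℝ)))
      (min ((n : ℝ) ^ (-(1 / 4) : ℝ)) ((p : ℝ) ^ (1 / 4 : ℝ) / √(n : ℝ))))
    (hwr : w ≤ r ^ 2 / 2) :
    ∃ k m : ℕ, 1 ≤ k ∧ k ≤ s ∧ 1 ≤ m ∧ k * m ≤ p ∧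
      k * ((Real.exp (n * w / k) - 1) / m) ≤ 4 := by
  have hn' : (0 : ℝ) < n := by positivity
  have hp : 1 ≤ p := hs.trans hsp
  have hp' : (0 : ℝ) < p := by positivity
  have hs' : (0 : ℝ) < s := by positivity
  have hr0 : 0 ≤ r := by rw [hr]; positivity
  have hq1 : 1 ≤ Nat.sqrt p := Nat.le_sqrt.2 (by simpa using hp)
  have hlogpos : 0 ≤ Real.log (2 + (p : ℝ) / (s : ℝ) ^ 2) :=
    Real.log_nonneg (by have : 0 ≤ (p : ℝ) / (s : ℝ) ^ 2 := by positivity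
                        linarith)
  have hr1 : r ^ 2 ≤ s * Real.log (2 + (p : ℝ) / (s : ℝ) ^ 2) / n := by
    rw [← Real.sq_sqrt (show 0 ≤ s * Real.log (2 + (p : ℝ) / (s : ℝ) ^ 2) / n by positivity)]
    exact pow_le_pow_left₀ hr0 (hr.le.trans (min_le_left _ _)) 2
  have hr2 : r ^ 2 ≤ √p / n := by
    have : √(p : ℝ) / n = ((p : ℝ) ^ (1 / 4 : ℝ) / √(n : ℝ)) ^ 2 := by
      rw [div_pow, Real.sq_sqrt hn'.le, ← Real.rpow_natCast, ← Real.rpow_mul hp'.le,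
        Real.sqrt_eq_rpow]
      norm_num
    rw [this]
    exact pow_le_pow_left₀ hr0
      (hr.le.trans ((min_le_right _ _).trans (min_le_right _ _))) 2
  obtain ⟨k, hk1, hks, hkk, hexp⟩ : ∃ k : ℕ, 1 ≤ k ∧ k ≤ s ∧ k * k ≤ p ∧
      Real.exp (n * w / k) ≤ 2 + (p : ℝ) / (k : ℝ) ^ 2 := by
    -- For `s ≤ ⌊√p⌋` the logarithmic term of the rate gives the bound. Otherwise `p ^ (1/4) / √n`
    -- gives `n w / k ≤ √p / (2k) ≤ 1`, and `e < 3 ≤ 2 + p / k²`.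
    by_cases hcase : s ≤ Nat.sqrt p
    · refine ⟨s, hs, le_rfl, Nat.le_sqrt.1 hcase, ?_⟩
      rw [← Real.le_log_iff_exp_le (by positivity), div_le_iff₀ hs']
      rw [le_div_iff₀ hn'] at hr1
      nlinarith [mul_nonneg hs'.le hlogpos]
    · have hqs : Nat.sqrt p ≤ s := (not_le.1 hcase).le
      refine ⟨Nat.sqrt p, hq1, hqs, Nat.sqrt_le p, ?_⟩
      have hq' : (1 : ℝ) ≤ Nat.sqrt p := by exact_mod_cast hq1
      have hsqrt : √(p : ℝ) ≤ 2 * Nat.sqrt p := by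
        have := (Real.sqrt_lt_sqrt hp'.le
          (show (p : ℝ) < ((Nat.sqrt p : ℝ) + 1) ^ 2 by
            exact_mod_cast (by simpa [sq] using Nat.lt_succ_sqrt p :
              p < (Nat.sqrt p + 1) ^ 2))).le
        rw [Real.sqrt_sq (by positivity)] at this
        linarith
      have hle : n * w / Nat.sqrt p ≤ 1 := by
        rw [div_le_one (by positivity)]
        rw [le_div_iff₀ hn'] at hr2
        nlinarith
      have hone : 1 ≤ (p : ℝ) / (Nat.sqrt p : ℝ) ^ 2 := by
        rw [one_le_div (by positivity)]
        exact_mod_cast Nat.sqrt_le' p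
      have := Real.exp_le_exp.2 hle
      linarith [Real.exp_one_lt_d9]
  have hkpos : (0 : ℝ) < k := by positivity
  have hkp : k ≤ p := (Nat.le_mul_of_pos_right k hk1).trans hkk
  have hm1 : 1 ≤ p / k := (Nat.one_le_div_iff hk1).2 hkp
  refine ⟨k, p / k, hk1, hks, hm1, Nat.mul_div_le p k, ?_⟩
  have hm' : (0 : ℝ) < (p / k : ℕ) := by exact_mod_cast hm1
  have hm2 : (p : ℝ) ≤ 2 * k * (p / k : ℕ) := by
    have h1 : p < k * (p / k) + k := by
      have := Nat.mod_lt p hk1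
      have := Nat.div_add_mod p k
      omega
    have h2 : k ≤ k * (p / k) := Nat.le_mul_of_pos_right k hm1
    exact_mod_cast (by nlinarith : p ≤ 2 * k * (p / k))
  have hkk' : (k : ℝ) * k ≤ p := by exact_mod_cast hkk
  have hu : (k : ℝ) * (1 + p / (k : ℝ) ^ 2) = (k * k + p) / k := by field_simp
  calc (k : ℝ) * ((Real.exp (n * w / k) - 1) / (p / k : ℕ))
      ≤ k * ((1 + p / (k : ℝ) ^ 2) / (p / k : ℕ)) := by gcongr; linarith
    _ = (k * k + p) / k / (p / k : ℕ) := by rw [← hu]; ring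
    -- Uses `k² ≤ p ≤ 2 k m`, where `m = ⌊p / k⌋`.
    _ ≤ 4 := by
        rw [div_div, div_le_iff₀ (by positivity)]
        nlinarith

end SparseRegression

/-! ### Choice of constants and conclusion. -/

open SparseRegression in
theorem theorem5 (σX : ℝ≥0) (hσX : 0 < σX) :
    ∃ c : ℝ, 0 < c ∧
      ∀ (n p s : ℕ) (σ : ℝ), 1 ≤ n → 1 ≤ s → s ≤ p → 0 < σ →
      ∀ (PX : Measure (Matrix (Fin n) (Fin p) ℝ)) [IsProbabilityMeasure PX],
        SparseRegression.IsIsotropic PX →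
        SparseRegression.HasIndepSubgaussianRows σX PX →
        ENNReal.ofReal (c * SparseRegression.rate n p s σ ^ 2) ≤
          SparseRegression.minimaxRisk PX σ s := by
  have hb : (0 : ℝ) < σX := hσX
  -- The first entry keeps `w = c₂ r²` in the range of the subexponential bound, as `r ≤ 1`; the
  -- second gives `w ≤ r² / 2` for the block parameters.
  set c₂ : ℝ := min (1 / (8 * (σX : ℝ) ^ 2)) (1 / 2) with hc₂
  have hc₂pos : 0 < c₂ := by positivity
  -- This is `ρ² / (16K)` with `ρ² = c₂ λ²` and `K = exp 8`: one factor `exp 4` comes from the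
  -- quadratic error of the design, the other from the block agreements.
  refine ⟨c₂ / (16 * Real.exp 8), by positivity, ?_⟩
  intro n p s σ hn hs hsp hσ PX _ hiso hrows
  have hn' : (0 : ℝ) < n := by positivity
  obtain ⟨r, hr⟩ : ∃ r : ℝ, r = min (√((s : ℝ) * Real.log (2 + (p : ℝ) / (s : ℝ) ^ 2) / (n : ℝ)))
      (min ((n : ℝ) ^ (-(1 / 4) : ℝ)) ((p : ℝ) ^ (1 / 4 : ℝ) / √(n : ℝ))) := ⟨_, rfl⟩
  have hrate : rate n p s σ = σ * r := by rw [rate, hr]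
  have hr0 : 0 ≤ r := by rw [hr]; positivity
  have hr4 : n * r ^ 4 ≤ 1 := by
    have h1 : r ^ 4 ≤ ((n : ℝ) ^ (-(1 / 4) : ℝ)) ^ 4 :=
      pow_le_pow_left₀ hr0 (hr.le.trans ((min_le_right _ _).trans (min_le_left _ _))) 4
    have h2 : ((n : ℝ) ^ (-(1 / 4) : ℝ)) ^ 4 = (n : ℝ)⁻¹ := by
      rw [← Real.rpow_natCast, ← Real.rpow_mul hn'.le]
      norm_num [Real.rpow_neg_one]
    rw [h2] at h1
    calc n * r ^ 4 ≤ n * (n : ℝ)⁻¹ := by gcongr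
      _ = 1 := mul_inv_cancel₀ hn'.ne'
  have hr1 : r ^ 2 ≤ 1 := by
    have : (1 : ℝ) ≤ n := by exact_mod_cast hn
    have h4 : (r ^ 2) ^ 2 ≤ 1 := by nlinarith [pow_nonneg hr0 4]
    exact (sq_le_one_iff₀ (by positivity)).1 h4
  set w : ℝ := c₂ * r ^ 2 with hw_def
  have hw : 0 ≤ w := by positivity
  have hwb : w ≤ 1 / (8 * (σX : ℝ) ^ 2) :=
    (mul_le_of_le_one_right hc₂pos.le hr1).trans (min_le_left _ _)
  have hquart : n * (256 * ((σX : ℝ) ^ 2 * w) ^ 2) ≤ 4 := by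
    have h1 : (σX : ℝ) ^ 2 * c₂ ≤ 1 / 8 := by
      calc (σX : ℝ) ^ 2 * c₂ ≤ (σX : ℝ) ^ 2 * (1 / (8 * (σX : ℝ) ^ 2)) := by
            gcongr; exact min_le_left _ _
        _ = 1 / 8 := by field_simp
    have h2 : ((σX : ℝ) ^ 2 * c₂) ^ 2 ≤ 1 / 64 := by
      calc ((σX : ℝ) ^ 2 * c₂) ^ 2 ≤ (1 / 8) ^ 2 := by gcongr
        _ = 1 / 64 := by norm_num
    calc n * (256 * ((σX : ℝ) ^ 2 * w) ^ 2)
        = 256 * ((σX : ℝ) ^ 2 * c₂) ^ 2 * (n * r ^ 4) := by rw [hw_def]; ring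
      _ ≤ 256 * (1 / 64) * 1 := by gcongr
      _ = 4 := by norm_num
  obtain ⟨k, m, hk, hks, hm, hkm, hagree⟩ := exists_block_parameters (w := w) hn hs hsp hr
    (by rw [hw_def]; nlinarith [min_le_right (1 / (8 * (σX : ℝ) ^ 2)) (1 / 2), sq_nonneg r])
  have hne : Nonempty (Fin m) := ⟨⟨0, hm⟩⟩
  have hρsq : (σ * √c₂ * r) ^ 2 = σ ^ 2 * w := by
    rw [hw_def, mul_pow, mul_pow, Real.sq_sqrt hc₂pos.le]; ring
  have hmain := le_minimaxRisk_of_chiSquare_le (s := s) PX (σ := σ) (ρ := σ * √c₂ * r)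
    (K := Real.exp 8) hσ (by positivity) (Real.one_le_exp (by norm_num))
    (θ := fun f : Fin k → Fin m => (σ * √c₂ * r) • blockVector hkm f)
    (fun f => by
      rw [norm_smul, norm_blockVector hk, mul_one, Real.norm_of_nonneg (by positivity)])
    (fun f => smul_blockVector_mem_sparseBall hks hkm f _) ?_
  · refine le_trans (le_of_eq ?_) hmain
    rw [hρsq, hrate, hw_def]
    congr 1
    ring
  have hterm : ∀ f g : Fin k → Fin m, ∫⁻ X, ENNReal.ofReal (Real.exp (σ⁻¹ ^ 2 *
      inner ℝ (WithLp.toLp 2 (X.mulVec ((σ * √c₂ * r) • blockVector hkm f).ofLp))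
        (WithLp.toLp 2 (X.mulVec ((σ * √c₂ * r) • blockVector hkm g).ofLp)))) ∂PX ≤
      ENNReal.ofReal (Real.exp 4 *
        Real.exp (n * w / k * (Finset.univ.filter fun b => f b = g b).card)) := fun f g => by
    have h1 := lintegral_exp_inner_mulVec_le hn hσX hiso hrows (norm_blockVector hk hkm f)
      (norm_blockVector hk hkm g) hw hwb
    refine le_trans (le_of_eq ?_) (h1.trans ?_)
    · refine lintegral_congr fun X => ?_
      congr 2
      simp only [WithLp.ofLp_smul, Matrix.mulVec_smul, WithLp.toLp_smul, real_inner_smul_left,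
        real_inner_smul_right]
      rw [← mul_assoc (σ * √c₂ * r), ← sq, hρsq, ← mul_assoc]
      congr 1
      field_simp
    · rw [← Real.exp_add, inner_blockVector]
      refine ENNReal.ofReal_le_ofReal (Real.exp_le_exp.2 ?_)
      have : n * w * ((Finset.univ.filter fun b => f b = g b).card / (k : ℝ)) =
          n * w / k * (Finset.univ.filter fun b => f b = g b).card := by ring
      linarith
  refine (Finset.sum_le_sum fun f _ => Finset.sum_le_sum fun g _ => hterm f g).trans ?_
  simp_rw [← ENNReal.ofReal_sum_of_nonneg fun _ _ => mul_nonneg (Real.exp_pos _).le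
    (Real.exp_pos _).le, ← Finset.mul_sum]
  have hrow : ∀ f : Fin k → Fin m, ENNReal.ofReal (Real.exp 4 * ∑ g : Fin k → Fin m,
      Real.exp (n * w / k * (Finset.univ.filter fun b => f b = g b).card)) ≤
        ENNReal.ofReal ((m : ℝ) ^ k * Real.exp 8) := fun f => by
    refine ENNReal.ofReal_le_ofReal ?_
    calc Real.exp 4 * ∑ g : Fin k → Fin m,
          Real.exp (n * w / k * (Finset.univ.filter fun b => f b = g b).card)
        ≤ Real.exp 4 * ((m : ℝ) ^ k * Real.exp (k * ((Real.exp (n * w / k) - 1) / m))) := by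
          gcongr; exact sum_exp_card_agree_le hm _ f
      _ ≤ Real.exp 4 * ((m : ℝ) ^ k * Real.exp 4) := by gcongr
      _ = (m : ℝ) ^ k * Real.exp 8 := by
          rw [mul_left_comm, ← Real.exp_add]; norm_num
  refine (Finset.sum_le_sum fun f _ => hrow f).trans (le_of_eq ?_)
  rw [Finset.sum_const, Finset.card_univ, Fintype.card_pi, Finset.prod_const, Finset.card_univ,
    Fintype.card_fin, Fintype.card_fin, nsmul_eq_mul, ENNReal.ofReal_mul (by positivity),
    ENNReal.ofReal_pow (by positivity), ENNReal.ofReal_natCast]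
  push_cast
  ring
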